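/- A subset $A$ of a space $X$ is \emph{$C$-embedded} in $X$ if every continuous $f:A\to\mathbb R$ has a continuous extension to $X$, and \emph{$C^*$-embedded} if every bounded continuous $f:A\to\mathbb R$ has a bounded continuous extension to $X$. A \emph{closed copy of $\mathbb N$} in $X$ is a closed subspace of $X$ homeomorphic to the discrete space $\mathbb N$. $C(X)$ is the set of continuous functions $X\to\mathbb R$. Let $D=2^{<\omega}$ be the set of finite $0$-$1$ sequences with the discrete topology. Let $cD=D\cup2^\omega$ be topologized by making the points of $D$ isolated and letting the sets $U(x,n)=\{s\in cD: x\restriction n\subseteq s\}$, $n\in\omega$, be a neighbourhood base at $x\in2^\omega$; this is a compactification of $D$. Let $e:\beta D\to cD$ be the continuous extension of the identity of $D$, let $D^*=\beta D\setminus D$, and for $x\in2^\omega$ let $K_x=\{u\in D^*:e(u)=x\}$. Let $\mathbb C=2^\omega\cup\{\infty\}$, where the points of $2^\omega$ are isolated and the sets $U\ni\infty$ with $|\mathbb C\setminus U|\le\aleph_0$ form a neighbourhood base at $\infty$. Let $$\mathbb A=(\mathbb C\times D)\cup\bigcup_{x\in2^\omega}\{x\}\times K_x ,$$ a subspace of $\mathbb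 C\times\beta D$, and let $R=\{\infty\}\times D\subseteq\mathbb A$. Then: 1. $|C(\mathbb A)|=\mathfrak c$. 2. $R$ is a closed copy of $\mathbb N$ in $\mathbb A$ that is $C^*$-embedded but not $C$-embedded in $\mathbb A$. The standard map $E:\mathbb A\to\mathbb R^{C(\mathbb A)}$, $E(t)=(f(t))_{f\in C(\mathbb A)}$, is a closed embedding whose image is $C$-embedded, and $E[R]$ is a closed copy of $\mathbb N$ in $\mathbb R^{C(\mathbb A)}$ that is $C^*$-embedded but not $C$-embedded in $\mathbb R^{C(\mathbb A)}$. 3. Hence $\mathbb R^{\mathfrak c}$ contains a closed copy of $\mathbb N$ that is $C^*$-embedded but not $C$-embedded; a least cardinal $\kappa$ such that $\mathbb R^{\kappa}$ contains such a copy therefore exists, and it satisfies $\aleph_0<\kappa\le\mathfrak c$. -/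

import Mathlib

open Set Topology Cardinal
open scoped BoundedContinuousFunction

namespace Plank

/-! ### `C`- and `C*`-embedding, copies of `ℕ` -/

/-- `A` is `C`-embedded in `X`: every continuous `f : A → ℝ` has a continuous extension to `X`. -/
def IsCEmbedded {X : Type*} [TopologicalSpace X] (A : Set X) : Prop :=
  ∀ f : C(A, ℝ), ∃ g : C(X, ℝ), ∀ a : A, g a = f a

/-- `A` is `C*`-embedded in `X`: every bounded continuous `f : A → ℝ` has a bounded continuous
extension to `X`. -/
def IsCStarEmbedded {X : Type*} [TopologicalSpace X] (A : Set X) : Prop :=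
  ∀ f : A →ᵇ ℝ, ∃ g : X →ᵇ ℝ, ∀ a : A, g a = f a

/-- `N` is a closed copy of the discrete space `ℕ` in `X`. -/
def IsClosedCopyOfNat {X : Type*} [TopologicalSpace X] (N : Set X) : Prop :=
  IsClosed N ∧ Nonempty (N ≃ₜ ℕ)

/-- `N` is a closed copy of `ℕ` in `X` that is `C*`-embedded but not `C`-embedded. -/
def IsCStarNotCEmbeddedNat {X : Type*} [TopologicalSpace X] (N : Set X) : Prop :=
  IsClosedCopyOfNat N ∧ IsCStarEmbedded N ∧ ¬ IsCEmbedded N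

/-- The cardinals `κ` such that the power `ℝ^κ` contains a closed copy of `ℕ` that is
`C*`-embedded but not `C`-embedded. (Up to homeomorphism `ι → ℝ` depends only on `#ι`.) -/
def powersWithCStarNotCNat : Set Cardinal.{0} :=
  {κ | ∃ ι : Type, #ι = κ ∧ ∃ N : Set (ι → ℝ), IsCStarNotCEmbeddedNat N}

/-- The standard map `t ↦ (f t)_f` of `X` into the power `ℝ^{C(X)}`. -/
def standardEmbedding (X : Type*) [TopologicalSpace X] : X → (C(X, ℝ) → ℝ) :=
  fun t f => f t

/-! ### The tree `D = 2^{<ω}` and its compactification `cD = D ∪ 2^ω` -/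

/-- The tree `2^{<ω}` of finite `0-1` sequences. -/
def D : Type := List Bool

/-- `D` carries the discrete topology. -/
instance : TopologicalSpace D := ⊥

instance : DiscreteTopology D := ⟨rfl⟩

/-- The initial segment `x ↾ n`. -/
def restrict (x : ℕ → Bool) (n : ℕ) : List Bool := (List.range n).map x

/-- The underlying set `D ∪ 2^ω` of `cD`. -/
inductive CD : Type
  | node (s : D) : CD
  | branch (x : ℕ → Bool) : CD

/-- The wedge `U(x, n)`: all finite and infinite sequences that extend `x ↾ n`. -/
def wedge (x : ℕ → Bool) (n : ℕ) : Set CD :=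
  {p | match p with
    | .node s => restrict x n <+: (show List Bool from s)
    | .branch y => restrict x n = restrict y n}

theorem wedge_anti (x : ℕ → Bool) {m n : ℕ} (h : m ≤ n) : wedge x n ⊆ wedge x m := by
  have key : ∀ y : ℕ → Bool, restrict y m = (restrict y n).take m := by
    intro y
    simp [restrict, ← List.map_take, List.take_range, h]
  intro p hp
  cases p with
  | node s =>
    change restrict x n <+: (show List Bool from s) at hp
    change restrict x m <+: (show List Bool from s)
    rw [key x]
    exact (List.take_prefix _ _).trans hp
  | branch y =>
    change restrict x n = restrict y n at hp
    change restrict x m = restrict y m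
    rw [key x, key y, hp]

/-- The topology of `cD`: the points of `D` are isolated and the wedges `U(x, n)`, `n ∈ ω`,
form a neighbourhood base at `x ∈ 2^ω`. -/
instance : TopologicalSpace CD where
  IsOpen U := ∀ x, CD.branch x ∈ U → ∃ n, wedge x n ⊆ U
  isOpen_univ := fun _ _ => ⟨0, subset_univ _⟩
  isOpen_inter := by
    intro U V hU hV x hx
    obtain ⟨m, hm⟩ := hU x hx.1
    obtain ⟨n, hn⟩ := hV x hx.2
    exact ⟨max m n, subset_inter ((wedge_anti x (le_max_left m n)).trans hm)
      ((wedge_anti x (le_max_right m n)).trans hn)⟩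
  isOpen_sUnion := by
    intro S hS x hx
    obtain ⟨U, hU, hxU⟩ := hx
    obtain ⟨n, hn⟩ := hS U hU x hxU
    exact ⟨n, hn.trans (subset_sUnion_of_mem hU)⟩

theorem CD.isOpen_iff {U : Set CD} :
    IsOpen U ↔ ∀ x, CD.branch x ∈ U → ∃ n, wedge x n ⊆ U := Iff.rfl

/-- The sequence of entries of a point of `cD`, with value `none` beyond its length. -/
def CD.entry : CD → ℕ → Option Bool
  | .node s, n => (show List Bool from s)[n]?
  | .branch x, n => some (x n)

theorem CD.entry_of_mem_wedge {x : ℕ → Bool} {n i : ℕ} (hi : i < n) {p : CD}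
    (hp : p ∈ wedge x n) : p.entry i = some (x i) := by
  cases p with
  | node s =>
    obtain ⟨t, ht⟩ : restrict x n <+: (show List Bool from s) := hp
    change (show List Bool from s)[i]? = _
    rw [← ht, List.getElem?_append_left (by simpa [restrict] using hi)]
    simp [restrict, hi]
  | branch y =>
    have hp : restrict x n = restrict y n := hp
    have := congrArg (fun l => l[i]?) hp
    simpa [restrict, hi, CD.entry] using this.symm

theorem CD.mem_wedge_of_entry {x : ℕ → Bool} {n : ℕ} {p : CD}
    (h : ∀ i < n, p.entry i = some (x i)) : p ∈ wedge x n := by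
  cases p with
  | node s =>
    change restrict x n <+: (show List Bool from s)
    rw [List.prefix_iff_getElem?]
    intro i hi
    have hi' : i < n := by simpa [restrict] using hi
    have := h i hi'
    simpa [restrict, CD.entry] using this
  | branch y =>
    change (List.range n).map x = (List.range n).map y
    refine List.map_congr_left fun i hi => ?_
    have := h i (List.mem_range.1 hi)
    exact (Option.some.inj this).symm

theorem CD.entry_injective : Function.Injective CD.entry := by
  intro p q h
  cases p with
  | node s =>
    cases q with
    | node t => exact congrArg CD.node (List.ext_getElem? fun i => congrFun h i)
    | branch y =>
      have h1 : (show List Bool from s)[(show List Bool from s).length]? = some _ :=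
        congrFun h (show List Bool from s).length
      rw [List.getElem?_eq_none_iff.2 le_rfl] at h1
      cases h1
  | branch x =>
    cases q with
    | node t =>
      have h1 : some _ = (show List Bool from t)[(show List Bool from t).length]? :=
        congrFun h (show List Bool from t).length
      rw [List.getElem?_eq_none_iff.2 le_rfl] at h1
      cases h1
    | branch y => exact congrArg CD.branch (funext fun i => Option.some.inj (congrFun h i))

theorem CD.isOpen_entry (i : ℕ) (o : Option Bool) : IsOpen {p : CD | p.entry i = o} := by
  intro x hx
  refine ⟨i + 1, fun p hp => ?_⟩
  have hx : some (x i) = o := hx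
  exact (CD.entry_of_mem_wedge (Nat.lt_succ_self i) hp).trans hx

instance : T2Space CD := by
  refine ⟨fun p q hpq => ?_⟩
  obtain ⟨i, hi⟩ : ∃ i, p.entry i ≠ q.entry i := by
    by_contra! h
    exact hpq (CD.entry_injective (funext h))
  refine ⟨_, _, CD.isOpen_entry i (p.entry i), CD.isOpen_entry i (q.entry i), rfl, rfl, ?_⟩
  exact Set.disjoint_left.2 fun r hr hr' => hi (hr.symm.trans hr')

instance : CompactSpace CD := by
  refine ⟨isCompact_iff_ultrafilter_le_nhds.2 fun F _ => ?_⟩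
  have hlim : ∀ i, ∃ o : Option Bool, {p : CD | p.entry i = o} ∈ F := by
    intro i
    have h : (⋃ o ∈ (univ : Set (Option Bool)), {p : CD | p.entry i = o}) ∈ F := by
      refine Filter.mem_of_superset Filter.univ_mem fun p _ => ?_
      simp
    obtain ⟨o, _, ho⟩ := (Ultrafilter.finite_biUnion_mem_iff finite_univ).1 h
    exact ⟨o, ho⟩
  choose f hf using hlim
  by_cases hx : ∀ i, ∃ b, f i = some b
  · choose x hx using hx
    refine ⟨CD.branch x, mem_univ _, fun U hU => ?_⟩
    obtain ⟨V, hVU, hV, hxV⟩ := mem_nhds_iff.1 hU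
    obtain ⟨n, hn⟩ := CD.isOpen_iff.1 hV x hxV
    have h : (⋂ i ∈ Set.Iio n, {p : CD | p.entry i = f i}) ∈ (F : Filter CD) :=
      (Filter.biInter_mem (Set.finite_Iio n)).2 fun i _ => hf i
    refine Filter.mem_of_superset h fun p hp => hVU (hn (CD.mem_wedge_of_entry fun i hi => ?_))
    rw [← hx i]
    exact Set.mem_iInter₂.1 hp i hi
  · push Not at hx
    obtain ⟨n, hn⟩ := hx
    have hn : f n = none := by
      cases h : f n with
      | none => rfl
      | some b => exact absurd h (hn b)
    have h : (⋂ i ∈ Set.Iic n, {p : CD | p.entry i = f i}) ∈ (F : Filter CD) :=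
      (Filter.biInter_mem (Set.finite_Iic n)).2 fun i _ => hf i
    obtain ⟨p, hp⟩ := F.nonempty_of_mem h
    have hp' : ∀ i ≤ n, p.entry i = f i := fun i hi => Set.mem_iInter₂.1 hp i hi
    have key : ∀ q : CD, (∀ i ≤ n, q.entry i = f i) →
        ∃ s : D, q = .node s ∧ (show List Bool from s).length ≤ n := by
      intro q hq
      cases q with
      | node s =>
        refine ⟨s, rfl, ?_⟩
        have := (hq n le_rfl).trans hn
        exact List.getElem?_eq_none_iff.1 this
      | branch y => exact absurd ((hq n le_rfl).trans hn) (by simp [CD.entry])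
    obtain ⟨s, rfl, hs⟩ := key p hp'
    refine ⟨CD.node s, mem_univ _, fun U hU => Filter.mem_of_superset h fun q hq => ?_⟩
    have hq' : ∀ i ≤ n, q.entry i = f i := fun i hi => Set.mem_iInter₂.1 hq i hi
    obtain ⟨t, rfl, ht⟩ := key q hq'
    have : s = t := by
      refine List.ext_getElem? fun i => ?_
      rcases le_or_gt i n with hi | hi
      · exact (hp' i hi).trans (hq' i hi).symm
      · rw [List.getElem?_eq_none_iff.2 (hs.trans hi.le),
          List.getElem?_eq_none_iff.2 (ht.trans hi.le)]
    rw [← this]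
    exact mem_of_mem_nhds hU

/-! ### The plank `𝔸` -/

theorem continuous_node : Continuous CD.node := continuous_of_discreteTopology

/-- The continuous extension `e : βD → cD` of the identity map of `D`. -/
noncomputable def e : StoneCech D → CD := stoneCechExtend continuous_node

/-- `K_x = {u ∈ D* : e(u) = x}`, where `D* = βD ∖ D`. -/
def K (x : ℕ → Bool) : Set (StoneCech D) :=
  {u | u ∉ range (stoneCechUnit : D → StoneCech D) ∧ e u = CD.branch x}

/-- The underlying set `2^ω ∪ {∞}` of the space `ℂ`. -/
inductive C : Type
  | pt (x : ℕ → Bool) : C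
  | infty : C

/-- The points of `2^ω` are isolated in `ℂ`; the sets that contain `∞` and have a countable
complement form a neighbourhood base at `∞`. -/
instance : TopologicalSpace C where
  IsOpen U := C.infty ∈ U → Uᶜ.Countable
  isOpen_univ := by simp
  isOpen_inter := by
    intro U V hU hV h
    rw [compl_inter]
    exact (hU h.1).union (hV h.2)
  isOpen_sUnion := by
    rintro S hS ⟨U, hU, hi⟩
    exact (hS U hU hi).mono (compl_subset_compl.2 (subset_sUnion_of_mem hU))

/-- The set `(ℂ × D) ∪ ⋃_x {x} × K_x` in `ℂ × βD`. -/
def plankSet : Set (C × StoneCech D) :=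
  (Set.univ ×ˢ range (stoneCechUnit : D → StoneCech D)) ∪ ⋃ x : ℕ → Bool, {C.pt x} ×ˢ K x

/-- The plank `𝔸`, a subspace of `ℂ × βD`. -/
abbrev A : Type := plankSet

/-- The right-hand side `R = {∞} × D` of the plank `𝔸`. -/
def R : Set A :=
  {p | p.1 ∈ ({C.infty} : Set C) ×ˢ range (stoneCechUnit : D → StoneCech D)}

end Plank

namespace Plank

open Filter

/-! ### The standard map into the power `ℝ^{C(X)}` -/

section StandardEmbedding

variable {X : Type*} [TopologicalSpace X]

/-! A continuous function on `ℂ` is constant off a countable set. As `D` is countable, a continuous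
function on `𝔸` repeats its values on `{∞} × D` in all but countably many columns `{x} × D`. Since
`ℂ × D` is dense, countably many reals and columns code the function, so `C(𝔸)` has size at most
`𝔠`.

A bounded function on `R` extends to `βD` and thus, through the second coordinate, to `𝔸`. The
length function on `R` does not extend: some column `x` would carry it too, and it tends to infinity
along `x ↾ n`, which accumulates at a point of `K x` where the extension is finite.

The image of `𝔸` is closed because the entries of `e u` form a countable family of continuous
functions with Lindelöf joint fibres: copies of `ℂ` over nodes, compact sets `{x} × K_x` over
branches. `exists_forall_eq_of_mem_closure` turns this into closedness. Each function on the image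
extends by a coordinate projection, and the properties of `R` pass to `E[R]`. Countable powers of
`ℝ` are metrizable, hence normal, so Tietze excludes `κ ≤ ℵ₀`. -/

theorem continuous_standardEmbedding : Continuous (standardEmbedding X) :=
  continuous_pi fun f => f.continuous

/-- A point of the closure of the image of `X` in `ℝ^{C(X)}` agrees on countably many
coordinates with a point of the image. -/
theorem exists_forall_eq_of_mem_closure {z : C(X, ℝ) → ℝ}
    (hz : z ∈ closure (range (standardEmbedding X))) (f : ℕ → C(X, ℝ)) :
    ∃ t, ∀ n, f n t = z (f n) := by
  by_contra! h
  set l := comap (standardEmbedding X) (𝓝 z)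
  have : l.NeBot := comap_neBot_iff.2 fun s hs => by
    obtain ⟨_, ha, t, rfl⟩ := mem_closure_iff_nhds.1 hz s hs
    exact ⟨t, ha⟩
  have hlim : ∀ g : C(X, ℝ), Tendsto g l (𝓝 (z g)) := fun g =>
    ((continuous_apply g).tendsto z).comp tendsto_comap
  -- The sum of the `u n` vanishes exactly where all `f n` agree with `z`. The cut at 1 and the
  -- geometric weights make it converge uniformly.
  let u : ℕ → X → ℝ := fun n t => (1 / 2) ^ n * min 1 |f n t - z (f n)|
  have hu0 : ∀ n t, 0 ≤ u n t := fun n t => by positivity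
  have hub : ∀ n t, ‖u n t‖ ≤ (1 / 2 : ℝ) ^ n := fun n t => by
    rw [Real.norm_of_nonneg (hu0 n t)]
    exact mul_le_of_le_one_right (by positivity) (min_le_left _ _)
  have hcont : Continuous fun t => ∑' n, u n t :=
    continuous_tsum (fun n => by fun_prop) summable_geometric_two hub
  have hpos : ∀ t, 0 < ∑' n, u n t := fun t => by
    obtain ⟨n, hn⟩ := h t
    refine (Summable.of_norm_bounded summable_geometric_two fun n => hub n t).tsum_pos
      (fun n => hu0 n t) n ?_
    have := abs_pos.2 (sub_ne_zero.2 hn)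
    positivity
  have hlim0 : Tendsto (fun t => ∑' n, u n t) l (𝓝 (∑' _ : ℕ, (0 : ℝ))) := by
    refine tendsto_tsum_of_dominated_convergence summable_geometric_two (fun n => ?_)
      (Eventually.of_forall fun t n => hub n t)
    have h1 : Tendsto (fun t => |f n t - z (f n)|) l (𝓝 |z (f n) - z (f n)|) :=
      ((hlim (f n)).sub_const _).abs
    have h2 := (((tendsto_const_nhds (x := (1 : ℝ))).min h1).const_mul ((1 / 2 : ℝ) ^ n))
    simpa [u] using h2
  -- The reciprocal is itself a coordinate, so along `l` it has the finite limit `z k`, although the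
  -- sum tends to 0.
  let k : C(X, ℝ) := ⟨fun t => (∑' n, u n t)⁻¹, hcont.inv₀ fun t => (hpos t).ne'⟩
  have h1 : Tendsto (fun t => (∑' n, u n t) * k t) l (𝓝 ((∑' _ : ℕ, (0 : ℝ)) * z k)) :=
    hlim0.mul (hlim k)
  have h2 : (fun t => (∑' n, u n t) * k t) = fun _ => 1 :=
    funext fun t => mul_inv_cancel₀ (hpos t).ne'
  rw [h2, tsum_zero, zero_mul] at h1
  exact one_ne_zero (tendsto_nhds_unique tendsto_const_nhds h1)

theorem isEmbedding_standardEmbedding [T35Space X] : IsEmbedding (standardEmbedding X) := by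
  refine ⟨isInducing_iff_nhds.2 fun x => le_antisymm
    continuous_standardEmbedding.continuousAt.le_comap fun U hU => ?_, fun x y hxy => ?_⟩
  · obtain ⟨V, hVU, hV, hxV⟩ := mem_nhds_iff.1 hU
    obtain ⟨f, hf, hfx, hfV⟩ := CompletelyRegularSpace.completely_regular_isOpen x V hV hxV
    let g : C(X, ℝ) := ⟨fun t => f t, by fun_prop⟩
    refine ⟨{z | z g < 1}, (isOpen_lt (continuous_apply g) continuous_const).mem_nhds ?_,
      fun t ht => hVU ?_⟩
    · change (f x : ℝ) < 1
      simp [hfx]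
    · by_contra htV
      have ht : (f t : ℝ) < 1 := ht
      simp [hfV htV] at ht
  · by_contra hne
    obtain ⟨f, hf, hfne⟩ := separatesPoints_continuous_of_t35Space hne
    exact hfne (congrFun hxy ⟨f, hf⟩)

/-- If some countable family of continuous functions has Lindelöf joint fibres, then the standard
map of `X` into `ℝ^{C(X)}` is a closed embedding. -/
theorem isClosedEmbedding_standardEmbedding [T35Space X] (f : ℕ → C(X, ℝ))
    (hf : ∀ t₀, IsLindelof {t | ∀ n, f n t = f n t₀}) :
    IsClosedEmbedding (standardEmbedding X) := by
  refine ⟨isEmbedding_standardEmbedding, isClosed_of_closure_subset fun z hz => ?_⟩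
  obtain ⟨t₀, ht₀⟩ := exists_forall_eq_of_mem_closure hz f
  by_contra hne
  -- If `z` is not in the image, each point differs from `z` at some coordinate. On a Lindelöf fibre
  -- countably many coordinates suffice.
  obtain ⟨r, hr, hcov⟩ := (hf t₀).elim_countable_subcover (fun g : C(X, ℝ) => {t | g t ≠ z g})
    (fun g => isOpen_ne_fun g.continuous continuous_const) (fun t _ => by
      by_contra hall
      simp only [mem_iUnion, mem_ofPred_eq, not_exists, not_not] at hall
      exact hne ⟨t, funext hall⟩)
  -- Including `range f` forces the new agreement point into the fibre of `t₀`.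
  obtain ⟨g, hg⟩ := (hr.union (countable_range f)).exists_eq_range ⟨f 0, Or.inr ⟨0, rfl⟩⟩
  obtain ⟨t, ht⟩ := exists_forall_eq_of_mem_closure hz g
  have ht' : ∀ k ∈ r ∪ range f, k t = z k := fun k hk => by
    rw [hg] at hk
    obtain ⟨n, rfl⟩ := hk
    exact ht n
  have hmem := hcov (show t ∈ {t | ∀ n, f n t = f n t₀} from fun n =>
    (ht' _ (Or.inr ⟨n, rfl⟩)).trans (ht₀ n).symm)
  simp only [mem_iUnion, mem_ofPred_eq] at hmem
  obtain ⟨k, hk, hkt⟩ := hmem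
  exact hkt (ht' k (Or.inl hk))

theorem isCEmbedded_range_standardEmbedding (h : IsEmbedding (standardEmbedding X)) :
    IsCEmbedded (range (standardEmbedding X)) := by
  intro f
  refine ⟨⟨fun z => z (f.comp (h.toHomeomorph : C(X, range (standardEmbedding X)))),
    continuous_apply _⟩, ?_⟩
  rintro ⟨_, t, rfl⟩
  rfl

theorem IsClosedCopyOfNat.image {Y : Type*} [TopologicalSpace Y] {φ : X → Y}
    (h : IsClosedEmbedding φ) {N : Set X} (hN : IsClosedCopyOfNat N) :
    IsClosedCopyOfNat (φ '' N) :=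
  ⟨h.isClosedMap _ hN.1, hN.2.map fun j => (h.isEmbedding.homeomorphImage N).symm.trans j⟩

theorem IsCEmbedded.of_image {Y : Type*} [TopologicalSpace Y] {φ : X → Y}
    (h : IsEmbedding φ) {N : Set X} (hN : IsCEmbedded (φ '' N)) : IsCEmbedded N := by
  intro f
  obtain ⟨g, hg⟩ := hN (f.comp ((h.homeomorphImage N).symm : C(φ '' N, N)))
  refine ⟨g.comp ⟨φ, h.continuous⟩, fun a => ?_⟩
  exact (hg (h.homeomorphImage N a)).trans
    (congrArg f ((h.homeomorphImage N).symm_apply_apply a))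

theorem IsCStarEmbedded.image_standardEmbedding (h : IsEmbedding (standardEmbedding X))
    {N : Set X} (hN : IsCStarEmbedded N) : IsCStarEmbedded (standardEmbedding X '' N) := by
  intro f
  obtain ⟨g, hg⟩ := hN (f.compContinuous
    ((h.homeomorphImage N : N ≃ₜ _) : C(N, standardEmbedding X '' N)))
  -- The coordinate projection at `g` is unbounded on the power, so it is clamped to `[-‖g‖, ‖g‖]`,
  -- which changes nothing on the image.
  refine ⟨BoundedContinuousFunction.ofNormedAddCommGroup
    (fun z => max (-‖g‖) (min ‖g‖ (z g.toContinuousMap)))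
    (by fun_prop) ‖g‖ (fun z => ?_), ?_⟩
  · rw [Real.norm_eq_abs, abs_le]
    exact ⟨le_max_left _ _, max_le (by linarith [norm_nonneg g]) (min_le_left _ _)⟩
  · rintro ⟨_, t, ht, rfl⟩
    have h1 : g t = f ⟨standardEmbedding X t, t, ht, rfl⟩ := hg ⟨t, ht⟩
    have h2 := abs_le.1 (Real.norm_eq_abs (g t) ▸ g.norm_coe_le_norm t)
    change max (-‖g‖) (min ‖g‖ (g t)) = _
    rw [min_eq_right h2.2, max_eq_right h2.1, h1]

theorem IsCStarNotCEmbeddedNat.image_standardEmbedding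
    (h : IsClosedEmbedding (standardEmbedding X)) {N : Set X} (hN : IsCStarNotCEmbeddedNat N) :
    IsCStarNotCEmbeddedNat (standardEmbedding X '' N) :=
  ⟨hN.1.image h, hN.2.1.image_standardEmbedding h.isEmbedding,
    fun hC => hN.2.2 (hC.of_image h.isEmbedding)⟩

end StandardEmbedding

theorem _root_.IsClosed.isCEmbedded {X : Type*} [TopologicalSpace X] [NormalSpace X] {N : Set X}
    (hN : IsClosed N) : IsCEmbedded N := by
  intro f
  obtain ⟨g, hg⟩ := f.exists_restrict_eq hN
  exact ⟨g, fun a => DFunLike.congr_fun hg a⟩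

theorem aleph0_lt_of_mem_powersWithCStarNotCNat {κ : Cardinal.{0}}
    (hκ : κ ∈ powersWithCStarNotCNat) : ℵ₀ < κ := by
  obtain ⟨ι, rfl, N, hN⟩ := hκ
  by_contra! hle
  have : Countable ι := mk_le_aleph0_iff.1 hle
  let := TopologicalSpace.pseudoMetrizableSpacePseudoMetric (ι → ℝ)
  exact hN.2.2 hN.1.1.isCEmbedded

/-! ### The one-point Lindelöf extension `ℂ` of the discrete space `2^ω` -/

theorem C.isOpen_iff {U : Set C} : IsOpen U ↔ (C.infty ∈ U → Uᶜ.Countable) := Iff.rfl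

instance : T1Space C where
  t1 c := by
    rw [← isOpen_compl_iff, C.isOpen_iff, compl_compl]
    exact fun _ => countable_singleton c

instance : T35Space C where
  __ : CompletelyRegularSpace C :=
    .of_isTopologicalBasis_clopens <| TopologicalSpace.isTopologicalBasis_of_isOpen_of_nhds (fun _ hU => hU.isOpen)
      fun c U hcU hU => by
        by_cases h : C.infty ∈ U
        · exact ⟨U, ⟨isOpen_compl_iff.1 fun h' => absurd h h', hU⟩, hcU, Subset.rfl⟩
        · refine ⟨{c}, ⟨isClosed_singleton, fun h' => ?_⟩, rfl, singleton_subset_iff.2 hcU⟩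
          rw [mem_singleton_iff] at h'
          exact absurd (h' ▸ hcU) h

instance : LindelofSpace C where
  isLindelof_univ := isLindelof_of_countable_subcover fun {ι} U hU hcov => by
    obtain ⟨i₀, hi₀⟩ := mem_iUnion.1 (hcov (mem_univ C.infty))
    choose j hj using fun c : C => mem_iUnion.1 (hcov (mem_univ c))
    refine ⟨insert i₀ (j '' (U i₀)ᶜ), ((hU i₀ hi₀).image j).insert i₀, fun c _ => ?_⟩
    by_cases hc : c ∈ U i₀
    · exact mem_biUnion (mem_insert _ _) hc
    · exact mem_biUnion (mem_insert_of_mem _ (mem_image_of_mem j hc)) (hj c)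

/-- A continuous real function on `ℂ` is constant off a countable set. -/
theorem C.countable_ne_infty {φ : C → ℝ} (hφ : Continuous φ) :
    {c | φ c ≠ φ C.infty}.Countable := by
  refine (countable_iUnion fun n : ℕ => (?_ :
    (φ ⁻¹' Metric.ball (φ C.infty) (1 / ((n : ℝ) + 1)))ᶜ.Countable)).mono fun c hc => ?_
  · exact (Metric.isOpen_ball.preimage hφ) (Metric.mem_ball_self (by positivity))
  · obtain ⟨n, hn⟩ := exists_nat_one_div_lt (dist_pos.2 hc)
    exact mem_iUnion.2 ⟨n, fun h => (Metric.mem_ball.1 h).not_gt hn⟩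

/-! ### The map `e : βD → cD` -/

theorem continuous_e : Continuous e := continuous_stoneCechExtend _

theorem e_stoneCechUnit (s : D) : e (stoneCechUnit s) = CD.node s :=
  stoneCechExtend_stoneCechUnit _ s

theorem isOpen_singleton_node (s : D) : IsOpen {CD.node s} := fun x hx => by
  cases mem_singleton_iff.1 hx

/-- Nodes are isolated in `cD` and `D` is dense in `βD`: a second point over `s` would have a node
other than `s` near it, still mapped to `s`. -/
theorem e_eq_node_iff {u : StoneCech D} {s : D} : e u = CD.node s ↔ u = stoneCechUnit s := by
  refine ⟨fun h => ?_, fun h => h ▸ e_stoneCechUnit s⟩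
  by_contra hne
  obtain ⟨t, h1, h2⟩ := denseRange_stoneCechUnit.exists_mem_open
    (((isOpen_singleton_node s).preimage continuous_e).inter
      (isOpen_compl_singleton (x := stoneCechUnit s))) ⟨u, h, hne⟩
  have h3 : CD.node t = CD.node s := (e_stoneCechUnit t).symm.trans h1
  exact h2 (congrArg stoneCechUnit (CD.node.inj h3))

theorem isOpen_singleton_stoneCechUnit (s : D) : IsOpen {(stoneCechUnit s : StoneCech D)} := by
  have : {(stoneCechUnit s : StoneCech D)} = e ⁻¹' {CD.node s} :=
    ext fun u => e_eq_node_iff.symm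
  rw [this]
  exact (isOpen_singleton_node s).preimage continuous_e

theorem stoneCechUnit_injective : Function.Injective (stoneCechUnit : D → StoneCech D) :=
  fun s t h => CD.node.inj (by rw [← e_stoneCechUnit, h, e_stoneCechUnit])

theorem mem_K_iff {x : ℕ → Bool} {u : StoneCech D} : u ∈ K x ↔ e u = CD.branch x := by
  refine ⟨fun h => h.2, fun h => ⟨?_, h⟩⟩
  rintro ⟨s, rfl⟩
  rw [e_stoneCechUnit] at h
  cases h

/-- The initial segment `x ↾ n` as an element of `D`. -/
def initialNode (x : ℕ → Bool) (n : ℕ) : D := restrict x n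

theorem tendsto_node_initialNode (x : ℕ → Bool) :
    Tendsto (fun n => CD.node (initialNode x n)) atTop (𝓝 (CD.branch x)) := by
  refine tendsto_nhds.2 fun U hU hx => ?_
  obtain ⟨n, hn⟩ := CD.isOpen_iff.1 hU x hx
  filter_upwards [eventually_ge_atTop n] with m hm
  refine hn (wedge_anti x hm ?_)
  exact List.prefix_rfl

/-- The points `x ↾ n` accumulate at a point of `K_x`. -/
theorem exists_mem_K_mapClusterPt (x : ℕ → Bool) :
    ∃ u ∈ K x, MapClusterPt u atTop fun n => (stoneCechUnit (initialNode x n) : StoneCech D) := by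
  obtain ⟨u, hu⟩ := exists_clusterPt_of_compactSpace
    (map (fun n => (stoneCechUnit (initialNode x n) : StoneCech D)) atTop)
  refine ⟨u, mem_K_iff.2 ?_, hu⟩
  have h1 : MapClusterPt (e u) atTop (e ∘ fun n => stoneCechUnit (initialNode x n)) :=
    MapClusterPt.continuousAt_comp continuous_e.continuousAt hu
  have h2 : (e ∘ fun n => stoneCechUnit (initialNode x n)) = fun n => CD.node (initialNode x n) :=
    funext fun n => e_stoneCechUnit _
  rw [h2] at h1
  have h3 : ClusterPt (e u) (𝓝 (CD.branch x)) := ClusterPt.mono h1 (tendsto_node_initialNode x)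
  exact eq_of_nhds_neBot h3

/-! ### The plank -/

/-- The point `(c, s)` of the plank. -/
def gridPoint (c : C) (s : D) : A := ⟨(c, stoneCechUnit s), Or.inl ⟨trivial, s, rfl⟩⟩

theorem continuous_gridPoint (s : D) : Continuous fun c => gridPoint c s :=
  (continuous_id.prodMk continuous_const).subtype_mk _

theorem eq_gridPoint_of_e_eq_node {t : A} {s : D} (h : e t.1.2 = CD.node s) :
    t = gridPoint t.1.1 s :=
  Subtype.ext (Prod.ext rfl (e_eq_node_iff.1 h))

/-- Points of `K x` occur in the plank only in column `x`. This makes `R` closed and the branch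
fibres compact. -/
theorem fst_eq_of_e_eq_branch {t : A} {x : ℕ → Bool} (h : e t.1.2 = CD.branch x) :
    t.1.1 = C.pt x := by
  obtain ⟨⟨c, u⟩, ⟨_, s, hs⟩ | ht⟩ := t
  · have hu : e u = CD.branch x := h
    have hs : stoneCechUnit s = u := hs
    rw [← hs, e_stoneCechUnit] at hu
    cases hu
  · obtain ⟨y, hc, hu⟩ := mem_iUnion.1 ht
    have h' : CD.branch y = CD.branch x := (mem_K_iff.1 hu).symm.trans h
    rw [← CD.branch.inj h']
    exact hc

theorem denseRange_gridPoint : DenseRange fun p : C × D => gridPoint p.1 p.2 := by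
  intro t
  rw [mem_closure_iff_nhds]
  intro U hU
  obtain ⟨V, hV, hVU⟩ := mem_nhds_subtype _ _ _ |>.1 hU
  obtain ⟨V₁, h₁, V₂, h₂, hsub⟩ := mem_nhds_prod_iff.1 hV
  obtain ⟨_, hs, s, rfl⟩ := mem_closure_iff_nhds.1 (denseRange_stoneCechUnit t.1.2) V₂ h₂
  exact ⟨gridPoint t.1.1 s, hVU (hsub ⟨mem_of_mem_nhds h₁, hs⟩), (t.1.1, s), rfl⟩

instance : Countable D := inferInstanceAs (Countable (List Bool))

instance : Infinite D := inferInstanceAs (Infinite (List Bool))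

/-- Off a countable set of columns, a continuous real function on the plank has the same
restriction to `{x} × D` as to `{∞} × D`. -/
theorem exists_countable_forall_notMem_eq (f : C(A, ℝ)) : ∃ S : Set (ℕ → Bool), S.Countable ∧
    ∀ x ∉ S, ∀ s, f (gridPoint (C.pt x) s) = f (gridPoint C.infty s) := by
  have h : (⋃ s, {c | f (gridPoint c s) ≠ f (gridPoint C.infty s)}).Countable :=
    countable_iUnion fun s => C.countable_ne_infty (f.continuous.comp (continuous_gridPoint s))
  refine ⟨C.pt ⁻¹' _, h.preimage fun x y hxy => C.pt.inj hxy, fun x hx s => ?_⟩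
  by_contra hne
  exact hx (mem_iUnion.2 ⟨s, hne⟩)

theorem mk_continuousMap_plank : #C(A, ℝ) = 𝔠 := by
  refine le_antisymm ?_ ?_
  · have h : ∀ f : C(A, ℝ), ∃ q : ℕ → ℕ → Bool, ∀ x ∉ range q, ∀ s,
        f (gridPoint (C.pt x) s) = f (gridPoint C.infty s) := fun f => by
      obtain ⟨S, hS, hf⟩ := exists_countable_forall_notMem_eq f
      obtain ⟨q, hq⟩ := countable_iff_exists_subset_range.1 hS
      exact ⟨q, fun x hx => hf x fun hxS => hx (hq hxS)⟩
    choose q hq using h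
    -- The code of `f`: its values on `R`, a list of the exceptional columns, and its values there.
    -- There are `𝔠` codes.
    let Φ : C(A, ℝ) → (D → ℝ) × (ℕ → ℕ → Bool) × (ℕ → D → ℝ) := fun f =>
      (fun s => f (gridPoint C.infty s), q f, fun n s => f (gridPoint (C.pt (q f n)) s))
    have hΦ : Function.Injective Φ := fun f g hfg => by
      have h1 : ∀ s, f (gridPoint C.infty s) = g (gridPoint C.infty s) :=
        congrFun (congrArg Prod.fst hfg)
      have h2 : q f = q g := congrArg (fun p => p.2.1) hfg
      have h3 : ∀ n s, f (gridPoint (C.pt (q f n)) s) = g (gridPoint (C.pt (q g n)) s) :=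
        fun n s => congrFun (congrFun (congrArg (fun p => p.2.2) hfg) n) s
      refine DFunLike.coe_injective (denseRange_gridPoint.equalizer f.continuous g.continuous ?_)
      funext ⟨c, s⟩
      cases c with
      | infty => exact h1 s
      | pt x =>
        by_cases hx : x ∈ range (q f)
        · obtain ⟨n, rfl⟩ := hx
          have := h3 n s
          rwa [← h2] at this
        · exact (hq f x hx s).trans ((h1 s).trans (hq g x (h2 ▸ hx) s).symm)
    refine (mk_le_of_injective hΦ).trans_eq ?_
    simp [mk_real]
  · rw [← mk_real]
    refine mk_le_of_injective (f := fun r : ℝ => ContinuousMap.const A r) fun r r' h => ?_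
    exact DFunLike.congr_fun h (gridPoint C.infty ([] : List Bool))

theorem mem_R_iff {t : A} : t ∈ R ↔ t.1.1 = C.infty := by
  refine ⟨fun h => h.1, fun h => ⟨h, ?_⟩⟩
  cases hs : e t.1.2 with
  | node s => exact ⟨s, (e_eq_node_iff.1 hs).symm⟩
  | branch x =>
    rw [fst_eq_of_e_eq_branch hs] at h
    cases h

theorem isClosed_R : IsClosed R := by
  have : R = (fun t : A => t.1.1) ⁻¹' {C.infty} := ext fun t => mem_R_iff
  rw [this]
  exact isClosed_singleton.preimage (by fun_prop)

/-- The bijection `s ↦ (∞, s)` of `D` onto the right-hand side of the plank. -/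
noncomputable def equivR : D ≃ R :=
  Equiv.ofBijective (fun s => ⟨gridPoint C.infty s, rfl, s, rfl⟩)
    ⟨fun s t h => stoneCechUnit_injective (congrArg (fun p : R => p.1.1.2) h), fun t => by
      obtain ⟨s, hs⟩ := t.2.2
      exact ⟨s, Subtype.ext (Subtype.ext (Prod.ext (mem_R_iff.1 t.2).symm hs))⟩⟩

instance : DiscreteTopology R := by
  refine discreteTopology_iff_isOpen_singleton.2 fun t => ?_
  obtain ⟨s, rfl⟩ := equivR.surjective t
  have : {equivR s} = (fun t : R => t.1.1.2) ⁻¹' {stoneCechUnit s} := by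
    ext t
    obtain ⟨s', rfl⟩ := equivR.surjective t
    exact equivR.injective.eq_iff.trans stoneCechUnit_injective.eq_iff.symm
  rw [this]
  exact (isOpen_singleton_stoneCechUnit s).preimage (by fun_prop)

theorem isClosedCopyOfNat_R : IsClosedCopyOfNat R := by
  obtain ⟨φ⟩ : Nonempty (D ≃ ℕ) := nonempty_equiv_of_countable
  exact ⟨isClosed_R, ⟨(equivR.symm.trans φ).toHomeomorphOfDiscrete⟩⟩

theorem isCStarEmbedded_R : IsCStarEmbedded R := by
  intro f
  have : CompactSpace (Icc (-‖f‖) ‖f‖) := isCompact_iff_compactSpace.1 isCompact_Icc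
  let h : D → Icc (-‖f‖) ‖f‖ := fun s => ⟨f (equivR s), by
    rw [mem_Icc, ← abs_le]
    exact f.norm_coe_le_norm _⟩
  have hh : Continuous h := continuous_of_discreteTopology
  have hc : Continuous fun t : A => ((stoneCechExtend hh t.1.2 : Icc (-‖f‖) ‖f‖) : ℝ) :=
    continuous_subtype_val.comp ((continuous_stoneCechExtend hh).comp (by fun_prop))
  refine ⟨.ofNormedAddCommGroup _ hc ‖f‖ fun t => ?_, fun a => ?_⟩
  · rw [Real.norm_eq_abs, abs_le]
    exact (stoneCechExtend hh t.1.2).2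
  · obtain ⟨s, rfl⟩ := equivR.surjective a
    exact congrArg Subtype.val (stoneCechExtend_stoneCechUnit hh s)

theorem not_isCEmbedded_R : ¬ IsCEmbedded R := by
  intro h
  let len : D → ℝ := fun s => (List.length s : ℝ)
  obtain ⟨g, hg⟩ := h ⟨fun a => len (equivR.symm a),
    continuous_of_discreteTopology⟩
  have hlen : ∀ s, g (gridPoint C.infty s) = len s := fun s =>
    (hg (equivR s)).trans (congrArg len (equivR.symm_apply_apply s))
  obtain ⟨S, hS, hgS⟩ := exists_countable_forall_notMem_eq g
  obtain ⟨x, hx⟩ : ∃ x, x ∉ S := by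
    by_contra! hall
    rw [eq_univ_of_forall hall, countable_univ_iff, ← mk_le_aleph0_iff] at hS
    exact hS.not_gt (by simpa using aleph0_lt_continuum)
  -- Near `(x, u)`, continuity keeps `g` below `g t + 1`, yet `g` equals the length `n` at nodes `x
  -- ↾ n` arbitrarily far along the branch.
  obtain ⟨u, hu, hclus⟩ := exists_mem_K_mapClusterPt x
  let t : A := ⟨(C.pt x, u), Or.inr (mem_iUnion.2 ⟨x, rfl, hu⟩)⟩
  have hU : g ⁻¹' Iio (g t + 1) ∈ 𝓝 t :=
    (isOpen_Iio.preimage g.continuous).mem_nhds (lt_add_one (g t))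
  obtain ⟨V, hV, hVU⟩ := mem_nhds_subtype _ _ _ |>.1 hU
  obtain ⟨V₁, h₁, V₂, h₂, hsub⟩ := mem_nhds_prod_iff.1 hV
  obtain ⟨N, hN⟩ := exists_nat_gt (g t + 1)
  obtain ⟨n, hnN, hn⟩ := frequently_atTop.1 (mapClusterPt_iff_frequently.1 hclus V₂ h₂) N
  have h3 : g (gridPoint (C.pt x) (initialNode x n)) < g t + 1 :=
    hVU (hsub ⟨mem_of_mem_nhds h₁, hn⟩ : gridPoint (C.pt x) (initialNode x n) ∈ Subtype.val ⁻¹' V)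
  rw [hgS x hx, hlen] at h3
  have h4 : len (initialNode x n) = n := by simp [len, initialNode, restrict]
  rw [h4] at h3
  have : (N : ℝ) ≤ n := by exact_mod_cast hnN
  linarith

/-- The entry `i` of `e u`, coded by a real number, as a continuous function of `(c, u) ∈ 𝔸`. -/
noncomputable def codedEntry (i : ℕ) : C(A, ℝ) where
  toFun t := (Encodable.encode ((e t.1.2).entry i) : ℝ)
  continuous_toFun := by
    have h : IsLocallyConstant fun p : CD => p.entry i :=
      IsLocallyConstant.iff_isOpen_fiber.2 fun o => CD.isOpen_entry i o
    exact (h.comp fun o => (Encodable.encode o : ℝ)).continuous.comp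
      (continuous_e.comp (by fun_prop))

theorem forall_codedEntry_eq_iff {t t₀ : A} :
    (∀ i, codedEntry i t = codedEntry i t₀) ↔ e t.1.2 = e t₀.1.2 := by
  refine ⟨fun h => CD.entry_injective (funext fun i => ?_), fun h i => ?_⟩
  · exact Encodable.encode_injective (Nat.cast_injective (h i))
  · change (Encodable.encode ((e t.1.2).entry i) : ℝ) = _
    rw [h]
    rfl

theorem isLindelof_fiber_e (p : CD) : IsLindelof {t : A | e t.1.2 = p} := by
  cases p with
  | node s =>
    have : {t : A | e t.1.2 = CD.node s} = range fun c => gridPoint c s := by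
      ext t
      refine ⟨fun h => ⟨t.1.1, (eq_gridPoint_of_e_eq_node h).symm⟩, ?_⟩
      rintro ⟨c, rfl⟩
      exact e_stoneCechUnit s
    rw [this]
    exact isLindelof_range (continuous_gridPoint s)
  | branch x =>
    refine IsCompact.isLindelof ?_
    rw [Subtype.isCompact_iff]
    have : Subtype.val '' {t : A | e t.1.2 = CD.branch x} =
        {C.pt x} ×ˢ (e ⁻¹' {CD.branch x}) := by
      ext ⟨c, u⟩
      refine ⟨?_, fun ⟨hc, hu⟩ => ?_⟩
      · rintro ⟨t, ht, htcu⟩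
        rw [← htcu]
        exact ⟨fst_eq_of_e_eq_branch ht, ht⟩
      · exact ⟨⟨(c, u), Or.inr (mem_iUnion.2 ⟨x, hc, mem_K_iff.2 hu⟩)⟩, hu, rfl⟩
    rw [this]
    exact isCompact_singleton.prod (isClosed_singleton.preimage continuous_e).isCompact

theorem isClosedEmbedding_standardEmbedding_plank : IsClosedEmbedding (standardEmbedding A) := by
  refine isClosedEmbedding_standardEmbedding codedEntry fun t₀ => ?_
  simp only [forall_codedEntry_eq_iff]
  exact isLindelof_fiber_e _

theorem isCStarNotCEmbeddedNat_R : IsCStarNotCEmbeddedNat R :=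
  ⟨isClosedCopyOfNat_R, isCStarEmbedded_R, not_isCEmbedded_R⟩

theorem continuum_mem_powersWithCStarNotCNat : 𝔠 ∈ powersWithCStarNotCNat :=
  ⟨C(A, ℝ), mk_continuousMap_plank, _,
    isCStarNotCEmbeddedNat_R.image_standardEmbedding isClosedEmbedding_standardEmbedding_plank⟩

end Plank

theorem mainTheorem5 :
    -- `C(𝔸)` has cardinality `𝔠`
    #C(Plank.A, ℝ) = 𝔠 ∧
    -- the right-hand side `R` of `𝔸` is a closed copy of `ℕ`, `C*`- but not `C`-embedded in `𝔸`
    Plank.IsCStarNotCEmbeddedNat Plank.R ∧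
    -- the standard embedding gives a closed and `C`-embedded copy of `𝔸` in `ℝ^{C(𝔸)}`
    IsClosedEmbedding (Plank.standardEmbedding Plank.A) ∧
    Plank.IsCEmbedded (range (Plank.standardEmbedding Plank.A)) ∧
    -- the image of `R` is a closed copy of `ℕ` in `ℝ^{C(𝔸)}`, `C*`- but not `C`-embedded
    Plank.IsCStarNotCEmbeddedNat (Plank.standardEmbedding Plank.A '' Plank.R) ∧
    -- hence there is such a copy of `ℕ` in `ℝ^𝔠`, and the minimal `κ` satisfies `ℵ₀ < κ ≤ 𝔠`
    𝔠 ∈ Plank.powersWithCStarNotCNat ∧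
    ∃ κ : Cardinal.{0}, IsLeast Plank.powersWithCStarNotCNat κ ∧ ℵ₀ < κ ∧ κ ≤ 𝔠 := by
  have hE := Plank.isClosedEmbedding_standardEmbedding_plank
  have hc := Plank.continuum_mem_powersWithCStarNotCNat
  -- Cardinals are well-ordered, so the infimum of a nonempty set is attained.
  have hmin := csInf_mem ⟨_, hc⟩
  exact ⟨Plank.mk_continuousMap_plank, Plank.isCStarNotCEmbeddedNat_R, hE,
    Plank.isCEmbedded_range_standardEmbedding hE.isEmbedding,
    Plank.isCStarNotCEmbeddedNat_R.image_standardEmbedding hE, hc, _,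
    ⟨hmin, fun κ hκ => csInf_le' hκ⟩, Plank.aleph0_lt_of_mem_powersWithCStarNotCNat hmin,
    csInf_le' hc⟩
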